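/- Let $|\Psi\rangle_{AB}$ be a pure state (unit vector) of a finite-dimensional bipartite system $\mathbb C^{d_A}\otimes\mathbb C^{d_B}$, let $\rho_B=\mathrm{Tr}_A|\Psi\rangle\langle\Psi|$, and for real $\alpha>0$, $\alpha\neq1$, let $E_\alpha(\Psi)=\frac{1}{1-\alpha}\log\mathrm{Tr}[\rho_B^\alpha]$ be the Rényi entanglement entropy. For real $s\ne0$ define the generalised entanglement entropy $$E_{(\alpha,s)}(\Psi)=\frac{1}{s(1-\alpha)}\left[e^{s(1-\alpha)E_\alpha(\Psi)}-1\right],$$ and for $s=0$ let $E_{(\alpha,0)}:=E_\alpha$ (the limiting value). Let $$\Omega=\{(\alpha,s): 0<\alpha<1,\ s\le 1/\alpha\}\cup\{(\alpha,s):\alpha>1,\ s\ge 1/\alpha\}.$$ An SLOCC protocol consists of finitely many rounds; in each round one party applies to its own system a measurement given by finitely many Kraus operators $K_k$, $\sum_k K_k^\dagger K_k=1$ (whose output dimension may depend on $k$), communicates the result, and the continuation may depend on all previous results; at the end an outcome $m$ is reported, where several sequences of results may be reported as the same outcome. One writes $|\Psi\rangle\to\{p_m,|\Psi_m\rangle\}$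 if some such protocol, applied to $|\Psi\rangle\langle\Psi|$, produces for every outcome $m$ the unnormalised state $p_m|\Psi_m\rangle\langle\Psi_m|$ with $|\Psi_m\rangle$ a pure bipartite state (so $p_m\ge0$ and $\sum_mp_m=1$). Then for every $(\alpha,s)\in\Omega$, $E_{(\alpha,s)}$ is an entanglement monotone in the sense that (i) for every pure state $|\Psi\rangle_{AB}$, $E_{(\alpha,s)}(\Psi)=0$ if and only if $|\Psi\rangle_{AB}$ is separable, i.e. a product $|\phi\rangle_A\otimes|\chi\rangle_B$; (ii) whenever $|\Psi\rangle\to\{p_m,|\Psi_m\rangle\}$ by SLOCC, $\sum_m p_m\left[E_{(\alpha,s)}(\Psi_m)-E_{(\alpha,s)}(\Psi)\right]\le0$. Moreover, for every $\alpha>0$ with $\alpha\ne1$ and every pure state $|\Psi\rangle_{AB}$, $\lim_{s\to0,\,s\neq0}E_{(\alpha,s)}(\Psi)=E_\alpha(\Psi)$, and $E_{(\alpha,1)}(\Psi)=\frac{1}{1-\alpha}\left(\mathrm{Tr}[\rho_B^\alpha]-1\right)$, the Tsallis entropy of $\rho_B$. -/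

import Mathlib

open scoped Matrix Kronecker Topology
open Filter

noncomputable section

namespace Entanglement

/-- Vectors of the bipartite Hilbert space `ℂ^dA ⊗ ℂ^dB`, with coordinates in the product basis.
Pure states are the vectors of norm one. -/
abbrev Ket (dA dB : ℕ) : Type := EuclideanSpace ℂ (Fin dA × Fin dB)

/-- Operators on the bipartite Hilbert space `ℂ^dA ⊗ ℂ^dB`. -/
abbrev Op (dA dB : ℕ) : Type := Matrix (Fin dA × Fin dB) (Fin dA × Fin dB) ℂ

/-- The operator `|Ψ⟩⟨Ψ|`. -/
def ketBra {dA dB : ℕ} (Ψ : Ket dA dB) : Op dA dB :=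
  Matrix.vecMulVec Ψ.ofLp (star Ψ.ofLp)

/-- The partial trace over the first subsystem. -/
def traceA {dA dB : ℕ} (M : Op dA dB) : Matrix (Fin dB) (Fin dB) ℂ :=
  Matrix.of fun j j' => ∑ i, M (i, j) (i, j')

/-- The local state `ρ_B = Tr_A |Ψ⟩⟨Ψ|`. -/
def localState {dA dB : ℕ} (Ψ : Ket dA dB) : Matrix (Fin dB) (Fin dB) ℂ :=
  traceA (ketBra Ψ)

/-- `Tr[ρ^α]`, where `ρ^α` is given by the functional calculus of the Hermitian matrix `ρ`. -/
def tracePow {d : ℕ} (α : ℝ) (ρ : Matrix (Fin d) (Fin d) ℂ) : ℝ :=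
  (Matrix.trace (cfc (fun x : ℝ => x ^ α) ρ)).re

/-- The Rényi entropy `S_α(ρ) = (1 - α)⁻¹ log Tr[ρ^α]`. -/
def renyiEntropy {d : ℕ} (α : ℝ) (ρ : Matrix (Fin d) (Fin d) ℂ) : ℝ :=
  1 / (1 - α) * Real.log (tracePow α ρ)

/-- The Tsallis entropy `T_α(ρ) = (1 - α)⁻¹ (Tr[ρ^α] - 1)`. -/
def tsallisEntropy {d : ℕ} (α : ℝ) (ρ : Matrix (Fin d) (Fin d) ℂ) : ℝ :=
  1 / (1 - α) * (tracePow α ρ - 1)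

/-- The Rényi entanglement entropy `E_α(Ψ) = S_α(ρ_B)`. -/
def REE {dA dB : ℕ} (α : ℝ) (Ψ : Ket dA dB) : ℝ :=
  renyiEntropy α (localState Ψ)

/-- The generalised entanglement entropy
`E_(α,s)(Ψ) = (exp (s (1 - α) E_α(Ψ)) - 1) / (s (1 - α))`. At `s = 0`, where this quotient is not
defined, it stands for its limit `E_α(Ψ)`. -/
def GEE {dA dB : ℕ} (α s : ℝ) (Ψ : Ket dA dB) : ℝ :=
  if s = 0 then REE α Ψ
  else 1 / (s * (1 - α)) * (Real.exp (s * (1 - α) * REE α Ψ) - 1)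

/-- The parameter region `Ω`. -/
def Ω : Set (ℝ × ℝ) :=
  {x | 0 < x.1 ∧ x.1 < 1 ∧ x.2 ≤ 1 / x.1} ∪ {x | 1 < x.1 ∧ 1 / x.1 ≤ x.2}

/-- A bipartite pure state is separable if it is a product `φ ⊗ χ`. -/
def IsSeparable {dA dB : ℕ} (Ψ : Ket dA dB) : Prop :=
  ∃ (φ : EuclideanSpace ℂ (Fin dA)) (χ : EuclideanSpace ℂ (Fin dB)),
    ∀ i j, Ψ (i, j) = φ i * χ j

/-- Stochastic LOCC protocols on `ℂ^dA ⊗ ℂ^dB`, as finite trees. A protocol either halts and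
reports an outcome `m`, or one of the parties performs a local measurement with finitely many
Kraus operators `K k` (whose output dimension may depend on the result `k`), communicates `k`, and
the protocol goes on in a way that may depend on `k`. The final systems of outcome `m` are
`ℂ^(outA m) ⊗ ℂ^(outB m)`. Several branches may report the same outcome, so that information can
be forgotten. -/
inductive Protocol {N : ℕ} (outA outB : Fin N → ℕ) : ℕ → ℕ → Type
  | halt (m : Fin N) : Protocol outA outB (outA m) (outB m)
  | alice {dA dB n : ℕ} (d' : Fin n → ℕ) (K : ∀ k, Matrix (Fin (d' k)) (Fin dA) ℂ)
      (complete : ∑ k, (K k)ᴴ * K k = 1)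
      (next : ∀ k, Protocol outA outB (d' k) dB) : Protocol outA outB dA dB
  | bob {dA dB n : ℕ} (d' : Fin n → ℕ) (K : ∀ k, Matrix (Fin (d' k)) (Fin dB) ℂ)
      (complete : ∑ k, (K k)ᴴ * K k = 1)
      (next : ∀ k, Protocol outA outB dA (d' k)) : Protocol outA outB dA dB

/-- The instrument implemented by a protocol: `P.run ρ m` is the unnormalised final state of
outcome `m` for the initial state `ρ`; its trace is the probability of `m`. -/
def Protocol.run {N : ℕ} {outA outB : Fin N → ℕ} {dA dB : ℕ} :
    Protocol outA outB dA dB → Op dA dB → (m : Fin N) → Op (outA m) (outB m)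
  | .halt m, ρ => Pi.single m ρ
  | .alice (dB := dB) _ K _ next, ρ => fun m =>
      ∑ k, (next k).run
        ((K k ⊗ₖ (1 : Matrix (Fin dB) (Fin dB) ℂ)) * ρ *
          (K k ⊗ₖ (1 : Matrix (Fin dB) (Fin dB) ℂ))ᴴ) m
  | .bob (dA := dA) _ K _ next, ρ => fun m =>
      ∑ k, (next k).run
        (((1 : Matrix (Fin dA) (Fin dA) ℂ) ⊗ₖ K k) * ρ *
          ((1 : Matrix (Fin dA) (Fin dA) ℂ) ⊗ₖ K k)ᴴ) m

/-- `Ψ` is transformed into the ensemble `{p_m, Ψ_m}` of pure states by an SLOCC protocol: outcome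
`m` occurs with probability `p m` and leaves the systems in the pure state `Φ m`. -/
def SLOCCTransforms {dA dB N : ℕ} {outA outB : Fin N → ℕ} (Ψ : Ket dA dB)
    (p : Fin N → ℝ) (Φ : ∀ m, Ket (outA m) (outB m)) : Prop :=
  ‖Ψ‖ = 1 ∧ (∀ m, ‖Φ m‖ = 1) ∧
    ∃ P : Protocol outA outB dA dB, ∀ m, P.run (ketBra Ψ) m = (p m : ℂ) • ketBra (Φ m)

/-- A function of bipartite pure states (of all local dimensions) is an entanglement monotone if it
vanishes exactly on the separable states and does not increase on average under SLOCC. -/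
structure IsEntanglementMonotone (E : ∀ {dA dB : ℕ}, Ket dA dB → ℝ) : Prop where
  eq_zero_iff : ∀ {dA dB : ℕ} (Ψ : Ket dA dB), ‖Ψ‖ = 1 → (E Ψ = 0 ↔ IsSeparable Ψ)
  average_le : ∀ {dA dB N : ℕ} {outA outB : Fin N → ℕ} (Ψ : Ket dA dB) (p : Fin N → ℝ)
    (Φ : ∀ m, Ket (outA m) (outB m)), SLOCCTransforms Ψ p Φ →
      ∑ m, p m * (E (Φ m) - E Ψ) ≤ 0

end Entanglement

end

/-!
Put `N(Ψ) = Tr[ρ_B^α]^(1/α)`, the Schatten norm (for `α < 1`, quasi-norm) of the local state. The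
generalised entanglement entropy is a deformed logarithm of it (`GEE_eq_deformedLog`):
`E_(α,s) = α / (1 - α) * (N^r - 1) / r` with `r = α s`.

*Monotonicity.* On positive semidefinite matrices the Schatten norm is homogeneous, subadditive for
`α ≥ 1` and superadditive for `α ≤ 1`: pass to an eigenbasis of the sum, where Minkowski's inequality
(`Lp_sum_le`), or its reverse (`sum_Lp_le`), applies to the diagonals, and compare each summand with
its diagonal by Peierls' inequality. A measurement by the first party splits `ρ_B` into a sum; a
measurement by the second party splits `ρ_A`, which has the same nonzero spectrum. So in every round
the sum of `N` over the unnormalised branches does not increase for `α < 1` and does not decrease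
for `α > 1`. Branches may be merged into one outcome, but since the final state of an outcome is
pure, all branches merged into it are proportional to it (`eq_smul_ketBra_of_sum_eq`), and
homogeneity of `N` makes their contributions add up. This gives `∑ p_m N(Ψ_m) ≤ N(Ψ)` for `α < 1`
and the reverse for `α > 1` (`IsLocalPotential.average_le`). The passage from `N` to `E_(α,s)` is Jensen's inequality: the
deformed logarithm is increasing, concave for `r ≤ 1` and convex for `r ≥ 1`, and `Ω` is exactly the
region where its shape matches the sign of `1 - α`.

*Faithfulness.* The eigenvalues `λ` of `ρ_B` sum to one, so `∑ λ^α = 1` only if every `λ` is `0` or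
`1`; then `ρ_B`, and with it the coefficient matrix of `Ψ`, has rank one, i.e. `Ψ` is a product.
-/

namespace Entanglement

open scoped ComplexOrder

/-! ### Trace powers and Peierls' inequality -/

theorem tracePow_eq_sum {d : ℕ} {A : Matrix (Fin d) (Fin d) ℂ} (hA : A.IsHermitian) (α : ℝ) :
    tracePow α A = ∑ i, hA.eigenvalues i ^ α := by
  rw [tracePow, hA.cfc_eq, Matrix.IsHermitian.cfc, Unitary.conjStarAlgAut_apply,
    Matrix.trace_mul_cycle]
  simp [Matrix.trace]

theorem tracePow_eq_sum_roots {d : ℕ} {A : Matrix (Fin d) (Fin d) ℂ} (hA : A.IsHermitian)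
    (α : ℝ) : tracePow α A = (A.charpoly.roots.map fun z => z.re ^ α).sum := by
  rw [tracePow_eq_sum hA, hA.roots_charpoly_eq_eigenvalues]
  simp [List.sum_ofFn]

/-- `M Mᴴ` and `Mᴴ M` have the same spectrum up to zeros, which `x ↦ x ^ α` does not see. -/
theorem tracePow_mul_conjTranspose_comm {m n : ℕ} (M : Matrix (Fin m) (Fin n) ℂ) {α : ℝ}
    (hα : 0 < α) : tracePow α (M * Mᴴ) = tracePow α (Mᴴ * M) := by
  rw [tracePow_eq_sum_roots (Matrix.isHermitian_mul_conjTranspose_self M),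
    tracePow_eq_sum_roots (Matrix.isHermitian_conjTranspose_mul_self M)]
  have h := congrArg Polynomial.roots (Matrix.charpoly_mul_comm' M Mᴴ)
  rw [Polynomial.roots_mul, Polynomial.roots_mul, Polynomial.roots_X_pow,
    Polynomial.roots_X_pow] at h
  · simpa [Multiset.map_nsmul, Multiset.sum_nsmul, Real.zero_rpow hα.ne'] using
      congrArg (fun s => (s.map fun z : ℂ => z.re ^ α).sum) h
  all_goals
    exact mul_ne_zero (pow_ne_zero _ Polynomial.X_ne_zero) (Matrix.charpoly_monic _).ne_zero

theorem tracePow_smul {d : ℕ} {A : Matrix (Fin d) (Fin d) ℂ} (hA : A.PosSemidef) {c : ℝ}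
    (hc : 0 ≤ c) (α : ℝ) : tracePow α ((c : ℂ) • A) = c ^ α * tracePow α A := by
  have hfin (f : ℝ → ℝ) : ContinuousOn f (spectrum ℝ A) :=
    Matrix.finite_real_spectrum.continuousOn f
  have h : cfc (fun x : ℝ => x ^ α) (c • A) = c ^ α • cfc (fun x : ℝ => x ^ α) A := by
    refine (cfc_comp_smul c (fun x : ℝ => x ^ α) A
      ((Matrix.finite_real_spectrum.image _).continuousOn _) hA.isHermitian).symm.trans
      (Eq.trans (cfc_congr fun x hx => ?_) (cfc_const_mul (c ^ α) _ A (hfin _)))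
    rw [hA.isHermitian.spectrum_real_eq_range_eigenvalues] at hx
    obtain ⟨i, rfl⟩ := hx
    exact Real.mul_rpow hc (hA.eigenvalues_nonneg i)
  rw [tracePow, Complex.coe_smul, h, Matrix.trace_smul, Complex.smul_re, smul_eq_mul, tracePow]

theorem tracePow_nonneg {d : ℕ} {A : Matrix (Fin d) (Fin d) ℂ} (hA : A.PosSemidef) (α : ℝ) :
    0 ≤ tracePow α A := by
  rw [tracePow_eq_sum hA.isHermitian]
  exact Finset.sum_nonneg fun i _ => Real.rpow_nonneg (hA.eigenvalues_nonneg i) α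

theorem sum_eigenvalues_eq {d : ℕ} {A : Matrix (Fin d) (Fin d) ℂ} (hA : A.IsHermitian) :
    ∑ i, hA.eigenvalues i = A.trace.re := by
  rw [hA.trace_eq_sum_eigenvalues]; simp

theorem tracePow_pos {d : ℕ} {A : Matrix (Fin d) (Fin d) ℂ} (hA : A.PosSemidef)
    (htr : 0 < A.trace.re) (α : ℝ) : 0 < tracePow α A := by
  rw [tracePow_eq_sum hA.isHermitian]
  rw [← sum_eigenvalues_eq hA.isHermitian] at htr
  obtain ⟨i, hi, hi0⟩ := Finset.exists_lt_of_sum_lt (by simpa using htr :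
    ∑ _i : Fin d, (0 : ℝ) < ∑ i, hA.isHermitian.eigenvalues i)
  exact Finset.sum_pos' (fun i _ => Real.rpow_nonneg (hA.eigenvalues_nonneg i) α)
    ⟨i, hi, Real.rpow_pos_of_pos hi0 α⟩

theorem row_norm_sq_sum {d : ℕ} {W : Matrix (Fin d) (Fin d) ℂ} (hW : W * Wᴴ = 1) (i : Fin d) :
    ∑ j, ‖W i j‖ ^ 2 = 1 := by
  have h := congrFun (congrFun hW i) i
  rw [Matrix.mul_apply, Matrix.one_apply_eq] at h
  simp only [Matrix.conjTranspose_apply, Complex.star_def, Complex.mul_conj'] at h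
  exact_mod_cast h

/-- The diagonal of a Hermitian matrix in any orthonormal basis is the image of its eigenvalues
under a doubly stochastic matrix. -/
theorem exists_doublyStochastic_diag {d : ℕ} {A : Matrix (Fin d) (Fin d) ℂ} (hA : A.IsHermitian)
    {U : Matrix (Fin d) (Fin d) ℂ} (hU : Uᴴ * U = 1) :
    ∃ w : Fin d → Fin d → ℝ, (∀ i j, 0 ≤ w i j) ∧ (∀ i, ∑ j, w i j = 1) ∧
      (∀ j, ∑ i, w i j = 1) ∧
      ∀ i, ((Uᴴ * A * U) i i).re = ∑ j, w i j * hA.eigenvalues j := by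
  set V : Matrix (Fin d) (Fin d) ℂ := (hA.eigenvectorUnitary : Matrix (Fin d) (Fin d) ℂ) with hV
  have hV1 : V * Vᴴ = 1 := Matrix.mem_unitaryGroup_iff.1 hA.eigenvectorUnitary.2
  set W := Uᴴ * V with hW
  have hW1 : W * Wᴴ = 1 := by
    rw [hW, Matrix.conjTranspose_mul, Matrix.conjTranspose_conjTranspose, Matrix.mul_assoc,
      ← Matrix.mul_assoc V, hV1, Matrix.one_mul, hU]
  have hW2 : Wᴴ * W = 1 := mul_eq_one_comm.1 hW1
  refine ⟨fun i j => ‖W i j‖ ^ 2, fun i j => by positivity, row_norm_sq_sum hW1, fun j => ?_,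
    fun i => ?_⟩
  · simpa using row_norm_sq_sum (W := Wᴴ) (by simpa using hW2) j
  · have h1 : Uᴴ * A * U = W * Matrix.diagonal (fun j => (hA.eigenvalues j : ℂ)) * Wᴴ := by
      conv_lhs => rw [hA.spectral_theorem, Unitary.conjStarAlgAut_apply]
      simp only [hW, Matrix.conjTranspose_mul, Matrix.conjTranspose_conjTranspose,
        Matrix.mul_assoc, Matrix.star_eq_conjTranspose, hV]
      rfl
    rw [h1, Matrix.mul_apply, Complex.re_sum]
    refine Finset.sum_congr rfl fun j _ => ?_
    rw [Matrix.mul_diagonal, Matrix.conjTranspose_apply, Complex.star_def, mul_right_comm,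
      Complex.mul_conj', ← Complex.ofReal_pow, ← Complex.ofReal_mul, Complex.ofReal_re]

/-- Peierls' inequality for the convex function `x ^ α`, `1 ≤ α`. -/
theorem sum_diag_rpow_le_tracePow {d : ℕ} {A : Matrix (Fin d) (Fin d) ℂ} (hA : A.PosSemidef)
    {U : Matrix (Fin d) (Fin d) ℂ} (hU : Uᴴ * U = 1) {α : ℝ} (hα : 1 ≤ α) :
    ∑ i, ((Uᴴ * A * U) i i).re ^ α ≤ tracePow α A := by
  obtain ⟨w, hw, hrow, hcol, hdiag⟩ := exists_doublyStochastic_diag hA.isHermitian hU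
  rw [tracePow_eq_sum hA.isHermitian]
  calc ∑ i, ((Uᴴ * A * U) i i).re ^ α
      ≤ ∑ i, ∑ j, w i j * hA.isHermitian.eigenvalues j ^ α := by
        refine Finset.sum_le_sum fun i _ => ?_
        rw [hdiag]
        exact (convexOn_rpow hα).map_sum_le (fun j _ => hw i j) (hrow i)
          fun j _ => hA.eigenvalues_nonneg j
    _ = ∑ j, hA.isHermitian.eigenvalues j ^ α := by
        rw [Finset.sum_comm]
        simp only [← Finset.sum_mul, hcol, one_mul]

/-- Peierls' inequality for the concave function `x ^ α`, `0 ≤ α ≤ 1`. -/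
theorem tracePow_le_sum_diag_rpow {d : ℕ} {A : Matrix (Fin d) (Fin d) ℂ} (hA : A.PosSemidef)
    {U : Matrix (Fin d) (Fin d) ℂ} (hU : Uᴴ * U = 1) {α : ℝ} (hα : 0 ≤ α) (hα1 : α ≤ 1) :
    tracePow α A ≤ ∑ i, ((Uᴴ * A * U) i i).re ^ α := by
  obtain ⟨w, hw, hrow, hcol, hdiag⟩ := exists_doublyStochastic_diag hA.isHermitian hU
  rw [tracePow_eq_sum hA.isHermitian]
  calc ∑ j, hA.isHermitian.eigenvalues j ^ α
      = ∑ i, ∑ j, w i j * hA.isHermitian.eigenvalues j ^ α := by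
        rw [Finset.sum_comm]
        simp only [← Finset.sum_mul, hcol, one_mul]
    _ ≤ ∑ i, ((Uᴴ * A * U) i i).re ^ α := by
        refine Finset.sum_le_sum fun i _ => ?_
        rw [hdiag]
        exact (Real.concaveOn_rpow hα hα1).le_map_sum (fun j _ => hw i j) (hrow i)
          fun j _ => hA.eigenvalues_nonneg j

/-! ### Subadditivity and superadditivity of the Schatten norm -/

/-- Minkowski's inequality for finitely many summands. -/
theorem Lp_sum_le {ι κ : Type*} [Fintype ι] [Fintype κ] {p : ℝ} (hp : 1 ≤ p) (a : κ → ι → ℝ)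
    (ha : ∀ k i, 0 ≤ a k i) :
    (∑ i, (∑ k, a k i) ^ p) ^ (1 / p) ≤ ∑ k, (∑ i, a k i ^ p) ^ (1 / p) := by
  have hp0 : 0 < p := by linarith
  have : Fact (1 ≤ ENNReal.ofReal p) := ⟨by simpa using hp⟩
  have hnorm (x : ι → ℝ) (hx : ∀ i, 0 ≤ x i) :
      ‖WithLp.toLp (ENNReal.ofReal p) x‖ = (∑ i, x i ^ p) ^ (1 / p) := by
    rw [PiLp.norm_eq_sum (by simpa [ENNReal.toReal_ofReal hp0.le] using hp0)]
    simp only [ENNReal.toReal_ofReal hp0.le, Real.norm_eq_abs, abs_of_nonneg (hx _)]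
  calc (∑ i, (∑ k, a k i) ^ p) ^ (1 / p)
      = ‖∑ k, WithLp.toLp (ENNReal.ofReal p) (a k)‖ := by
        rw [← WithLp.toLp_sum, hnorm]
        · simp
        · exact fun i => by simpa using Finset.sum_nonneg fun k _ => ha k i
    _ ≤ ∑ k, ‖WithLp.toLp (ENNReal.ofReal p) (a k)‖ := norm_sum_le _ _
    _ = _ := Finset.sum_congr rfl fun k _ => hnorm _ (ha k)

/-- The reverse Minkowski inequality. It is Minkowski's inequality for the exponent `1 / α`,
applied to the transposed family of the powers `a k i ^ α`. -/
theorem sum_Lp_le {ι κ : Type*} [Fintype ι] [Fintype κ] {α : ℝ} (hα : 0 < α) (hα1 : α ≤ 1)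
    (a : κ → ι → ℝ) (ha : ∀ k i, 0 ≤ a k i) :
    ∑ k, (∑ i, a k i ^ α) ^ (1 / α) ≤ (∑ i, (∑ k, a k i) ^ α) ^ (1 / α) := by
  have h := Lp_sum_le (p := 1 / α) (by rw [le_div_iff₀ hα]; linarith)
    (fun i k => a k i ^ α) fun i k => Real.rpow_nonneg (ha k i) α
  simp only [one_div_one_div, ← Real.rpow_mul (ha _ _), mul_one_div_cancel hα.ne',
    Real.rpow_one] at h
  have h0 : 0 ≤ ∑ k, (∑ i, a k i ^ α) ^ (1 / α) :=
    Finset.sum_nonneg fun k _ => Real.rpow_nonneg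
      (Finset.sum_nonneg fun i _ => Real.rpow_nonneg (ha k i) α) _
  have h2 := Real.rpow_le_rpow (Real.rpow_nonneg h0 _) h (by positivity : 0 ≤ 1 / α)
  rwa [← Real.rpow_mul h0, mul_one_div_cancel hα.ne', Real.rpow_one] at h2

/-- Peierls' inequality is an equality in an eigenbasis. -/
theorem exists_unitary_sum_diag {d : ℕ} {A : Matrix (Fin d) (Fin d) ℂ} (hA : A.IsHermitian)
    (α : ℝ) : ∃ U : Matrix (Fin d) (Fin d) ℂ, Uᴴ * U = 1 ∧
      tracePow α A = ∑ i, ((Uᴴ * A * U) i i).re ^ α := by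
  refine ⟨hA.eigenvectorUnitary, Matrix.mem_unitaryGroup_iff'.1 hA.eigenvectorUnitary.2, ?_⟩
  have h := hA.conjStarAlgAut_star_eigenvectorUnitary
  rw [Unitary.conjStarAlgAut_star_apply, Matrix.star_eq_conjTranspose] at h
  rw [tracePow_eq_sum hA, h]
  simp

/-- The Schatten norm (for `α < 1`, quasi-norm) `(Tr ρ^α)^(1/α)` of a positive semidefinite
matrix. -/
noncomputable def schattenNorm {d : ℕ} (α : ℝ) (ρ : Matrix (Fin d) (Fin d) ℂ) : ℝ :=
  tracePow α ρ ^ (1 / α)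

theorem sum_diag_re {d n : ℕ} (A : Fin n → Matrix (Fin d) (Fin d) ℂ)
    (U : Matrix (Fin d) (Fin d) ℂ) (i : Fin d) :
    ((Uᴴ * (∑ k, A k) * U) i i).re = ∑ k, ((Uᴴ * A k * U) i i).re := by
  simp [Matrix.mul_sum, Matrix.sum_mul, Matrix.sum_apply]

theorem diag_re_nonneg {d : ℕ} {A : Matrix (Fin d) (Fin d) ℂ} (hA : A.PosSemidef)
    (U : Matrix (Fin d) (Fin d) ℂ) (i : Fin d) : 0 ≤ ((Uᴴ * A * U) i i).re :=
  (Complex.le_def.1 (hA.conjTranspose_mul_mul_same U).diag_nonneg).1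

/-- In an eigenbasis of the sum, the Schatten norm of the sum is the `ℓ^α` norm of its diagonal;
Minkowski's inequality splits the diagonal and Peierls' inequality bounds the parts. -/
theorem schattenNorm_sum_le {d n : ℕ} {α : ℝ} (hα : 1 ≤ α)
    {A : Fin n → Matrix (Fin d) (Fin d) ℂ} (hA : ∀ k, (A k).PosSemidef) :
    schattenNorm α (∑ k, A k) ≤ ∑ k, schattenNorm α (A k) := by
  have hS : (∑ k, A k).PosSemidef := Matrix.posSemidef_sum _ fun k _ => hA k
  obtain ⟨U, hU, h⟩ := exists_unitary_sum_diag hS.isHermitian α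
  rw [schattenNorm, h]
  simp only [sum_diag_re]
  refine (Lp_sum_le hα (fun k i => ((Uᴴ * A k * U) i i).re)
    fun k i => diag_re_nonneg (hA k) U i).trans (Finset.sum_le_sum fun k _ => ?_)
  exact Real.rpow_le_rpow
    (Finset.sum_nonneg fun i _ => Real.rpow_nonneg (diag_re_nonneg (hA k) U i) α)
    (sum_diag_rpow_le_tracePow (hA k) hU hα) (by positivity)

/-- For exponents `α ≤ 1` both inequalities in the argument for `schattenNorm_sum_le` are
reversed. -/
theorem sum_schattenNorm_le {d n : ℕ} {α : ℝ} (hα : 0 < α) (hα1 : α ≤ 1)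
    {A : Fin n → Matrix (Fin d) (Fin d) ℂ} (hA : ∀ k, (A k).PosSemidef) :
    ∑ k, schattenNorm α (A k) ≤ schattenNorm α (∑ k, A k) := by
  have hS : (∑ k, A k).PosSemidef := Matrix.posSemidef_sum _ fun k _ => hA k
  obtain ⟨U, hU, h⟩ := exists_unitary_sum_diag hS.isHermitian α
  rw [schattenNorm, h]
  simp only [sum_diag_re]
  refine le_trans (Finset.sum_le_sum fun k _ => ?_) (sum_Lp_le hα hα1
    (fun k i => ((Uᴴ * A k * U) i i).re) fun k i => diag_re_nonneg (hA k) U i)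
  exact Real.rpow_le_rpow (tracePow_nonneg (hA k) α)
    (tracePow_le_sum_diag_rpow (hA k) hU hα.le hα1) (by positivity)

theorem schattenNorm_smul {d : ℕ} {A : Matrix (Fin d) (Fin d) ℂ} (hA : A.PosSemidef) {c : ℝ}
    (hc : 0 ≤ c) {α : ℝ} (hα : 0 < α) :
    schattenNorm α ((c : ℂ) • A) = c * schattenNorm α A := by
  rw [schattenNorm, tracePow_smul hA hc, Real.mul_rpow (by positivity) (tracePow_nonneg hA α),
    ← Real.rpow_mul hc, mul_one_div_cancel hα.ne', Real.rpow_one, schattenNorm]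

/-! ### The deformed logarithm -/

/-- The deformed logarithm `(x^r - 1) / r`, completed at `r = 0` by its limit `log x`. -/
noncomputable def deformedLog (r x : ℝ) : ℝ :=
  if r = 0 then Real.log x else (x ^ r - 1) / r

theorem deformedLog_le_sub_one {r u : ℝ} (hr : r ≤ 1) (hu : 0 < u) :
    deformedLog r u ≤ u - 1 := by
  rw [deformedLog]
  split_ifs with h0
  · exact Real.log_le_sub_one_of_pos hu
  · rcases lt_or_gt_of_ne h0 with h | h
    · rw [div_le_iff_of_neg h, Real.rpow_def_of_pos hu]
      nlinarith [Real.add_one_le_exp (Real.log u * r), Real.log_le_sub_one_of_pos hu]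
    · rw [div_le_iff₀ h]
      have := rpow_one_add_le_one_add_mul_self (s := u - 1) (by linarith) h.le hr
      rw [add_sub_cancel] at this
      linarith

theorem sub_one_le_deformedLog {r u : ℝ} (hr : 1 ≤ r) (hu : 0 < u) :
    u - 1 ≤ deformedLog r u := by
  rw [deformedLog, if_neg (by linarith), le_div_iff₀ (by linarith)]
  have := one_add_mul_self_le_rpow_one_add (s := u - 1) (by linarith) hr
  rw [add_sub_cancel] at this
  linarith

/-- The deformed logarithm of a quotient; it transports the tangent line bounds at `1` to `y`. -/
theorem deformedLog_eq_add {r x y : ℝ} (hx : 0 < x) (hy : 0 < y) :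
    deformedLog r x = deformedLog r y + y ^ r * deformedLog r (x / y) := by
  rw [deformedLog, deformedLog, deformedLog]
  split_ifs with h
  · rw [h, Real.rpow_zero, Real.log_div hx.ne' hy.ne']; ring
  · rw [Real.div_rpow hx.le hy.le]
    have := (Real.rpow_pos_of_pos hy r).ne'
    field_simp
    ring

theorem sum_mul_div_sub_one {ι : Type*} [Fintype ι] {p x : ι → ℝ} (hp1 : ∑ m, p m = 1) {y : ℝ} :
    ∑ m, p m * (x m / y - 1) = (∑ m, p m * x m) / y - 1 := by
  simp only [mul_sub, mul_one, Finset.sum_sub_distrib, hp1, Finset.sum_div, mul_div_assoc]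

/-- Jensen's inequality and monotonicity in one: for `r ≤ 1` the deformed logarithm is concave and
increasing. -/
theorem sum_deformedLog_sub_nonpos {ι : Type*} [Fintype ι] {p x : ι → ℝ} (hp : ∀ m, 0 ≤ p m)
    (hp1 : ∑ m, p m = 1) (hx : ∀ m, 0 < x m) {y r : ℝ} (hy : 0 < y) (hr : r ≤ 1)
    (h : ∑ m, p m * x m ≤ y) : ∑ m, p m * (deformedLog r (x m) - deformedLog r y) ≤ 0 := by
  have hyr := Real.rpow_pos_of_pos hy r
  calc ∑ m, p m * (deformedLog r (x m) - deformedLog r y)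
      = y ^ r * ∑ m, p m * deformedLog r (x m / y) := by
        rw [Finset.mul_sum]
        refine Finset.sum_congr rfl fun m _ => ?_
        rw [deformedLog_eq_add (hx m) hy]; ring
    _ ≤ y ^ r * ∑ m, p m * (x m / y - 1) := by
        gcongr with m
        · exact hp m
        · exact deformedLog_le_sub_one hr (div_pos (hx m) hy)
    _ ≤ 0 := by
        rw [sum_mul_div_sub_one hp1]
        exact mul_nonpos_of_nonneg_of_nonpos hyr.le (by rwa [sub_nonpos, div_le_one hy])

/-- The counterpart of `sum_deformedLog_sub_nonpos` for `1 ≤ r`, where the deformed logarithm is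
convex and increasing. -/
theorem sum_deformedLog_sub_nonneg {ι : Type*} [Fintype ι] {p x : ι → ℝ} (hp : ∀ m, 0 ≤ p m)
    (hp1 : ∑ m, p m = 1) (hx : ∀ m, 0 < x m) {y r : ℝ} (hy : 0 < y) (hr : 1 ≤ r)
    (h : y ≤ ∑ m, p m * x m) : 0 ≤ ∑ m, p m * (deformedLog r (x m) - deformedLog r y) := by
  have hyr := Real.rpow_pos_of_pos hy r
  calc 0 ≤ y ^ r * ∑ m, p m * (x m / y - 1) := by
        rw [sum_mul_div_sub_one hp1]
        exact mul_nonneg hyr.le (by rwa [sub_nonneg, one_le_div hy])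
    _ ≤ y ^ r * ∑ m, p m * deformedLog r (x m / y) := by
        gcongr with m
        · exact hp m
        · exact sub_one_le_deformedLog hr (div_pos (hx m) hy)
    _ = ∑ m, p m * (deformedLog r (x m) - deformedLog r y) := by
        rw [Finset.mul_sum]
        refine Finset.sum_congr rfl fun m _ => ?_
        rw [deformedLog_eq_add (hx m) hy]; ring

/-! ### Probability vectors with power sum one -/

theorem rpow_eq_self_iff {x α : ℝ} (hx : 0 ≤ x) (hα : 0 < α) (hα1 : α ≠ 1) :
    x ^ α = x ↔ x = 0 ∨ x = 1 := by
  constructor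
  · intro h
    rcases hx.eq_or_lt with h0 | h0
    · exact Or.inl h0.symm
    · right
      have hlog := congrArg Real.log h
      rw [Real.log_rpow h0] at hlog
      have : Real.log x = 0 := by
        have : (α - 1) * Real.log x = 0 := by linarith
        exact (mul_eq_zero.1 this).resolve_left (sub_ne_zero.2 hα1)
      exact Real.eq_one_of_pos_of_log_eq_zero h0 this
  · rintro (rfl | rfl)
    · exact Real.zero_rpow hα.ne'
    · exact Real.one_rpow α

theorem sum_rpow_eq_one_iff {ι : Type*} [Fintype ι] {x : ι → ℝ} (hx : ∀ i, 0 ≤ x i)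
    (hsum : ∑ i, x i = 1) {α : ℝ} (hα : 0 < α) (hα1 : α ≠ 1) :
    ∑ i, x i ^ α = 1 ↔ ∀ i, x i = 0 ∨ x i = 1 := by
  have hx1 (i : ι) : x i ≤ 1 := hsum ▸ Finset.single_le_sum (fun i _ => hx i) (Finset.mem_univ i)
  simp only [← rpow_eq_self_iff (hx _) hα hα1]
  refine ⟨fun h => ?_, fun h => by simp only [h, hsum]⟩
  rw [← hsum] at h
  rcases lt_or_gt_of_ne hα1 with h1 | h1
  · exact fun i => ((Finset.sum_eq_sum_iff_of_le fun i _ =>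
      Real.self_le_rpow_of_le_one (hx i) (hx1 i) h1.le).1 h.symm i (Finset.mem_univ i)).symm
  · exact fun i => (Finset.sum_eq_sum_iff_of_le fun i _ =>
      Real.rpow_le_self_of_le_one (hx i) (hx1 i) h1.le).1 h i (Finset.mem_univ i)

theorem forall_zero_or_one_iff_card_le_one {ι : Type*} [Fintype ι] {x : ι → ℝ}
    [DecidablePred fun i => x i ≠ 0] (hsum : ∑ i, x i = 1) :
    (∀ i, x i = 0 ∨ x i = 1) ↔ Fintype.card {i // x i ≠ 0} ≤ 1 := by
  constructor
  · intro h
    have hx (i : ι) : x i = if x i ≠ 0 then 1 else 0 := by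
      rcases h i with h | h <;> simp [h]
    rw [Finset.sum_congr rfl fun i _ => hx i, Finset.sum_boole] at hsum
    rw [Fintype.card_subtype]
    exact_mod_cast hsum.le
  · intro h i
    refine or_iff_not_imp_left.2 fun hi => ?_
    rw [← hsum, Finset.sum_eq_single i]
    · intro j _ hj
      by_contra hj0
      exact hj (congrArg Subtype.val
        (Fintype.card_le_one_iff.1 h ⟨j, hj0⟩ ⟨i, hi⟩))
    · simp

/-! ### Kets, local states and local operations -/

/-- The coefficients of a ket as a matrix `R` with rows indexed by the second subsystem, so that
`ρ_B = R Rᴴ`, while `Rᴴ R` has the spectrum of `ρ_A`. -/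
def coeffMatrix {dA dB : ℕ} (Ψ : Ket dA dB) : Matrix (Fin dB) (Fin dA) ℂ :=
  Matrix.of fun j i => Ψ (i, j)

theorem localState_eq {dA dB : ℕ} (Ψ : Ket dA dB) :
    localState Ψ = coeffMatrix Ψ * (coeffMatrix Ψ)ᴴ := by
  ext j j'
  simp [localState, traceA, ketBra, coeffMatrix, Matrix.mul_apply, Matrix.vecMulVec_apply]

theorem localState_posSemidef {dA dB : ℕ} (Ψ : Ket dA dB) : (localState Ψ).PosSemidef := by
  rw [localState_eq]
  exact Matrix.posSemidef_self_mul_conjTranspose _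

theorem ketBra_posSemidef {dA dB : ℕ} (Ψ : Ket dA dB) : (ketBra Ψ).PosSemidef :=
  Matrix.posSemidef_vecMulVec_self_star _

theorem trace_ketBra {dA dB : ℕ} (Ψ : Ket dA dB) :
    (ketBra Ψ).trace = ((‖Ψ‖ ^ 2 : ℝ) : ℂ) := by
  rw [EuclideanSpace.norm_sq_eq]
  simp [ketBra, Matrix.trace, Matrix.vecMulVec_apply, Complex.mul_conj']

theorem trace_localState {dA dB : ℕ} (Ψ : Ket dA dB) :
    (localState Ψ).trace = ((‖Ψ‖ ^ 2 : ℝ) : ℂ) := by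
  rw [← trace_ketBra]
  simp [localState, traceA, Matrix.trace, Fintype.sum_prod_type_right]

theorem localState_eq_smul {dA dB : ℕ} {v w : Ket dA dB} {c : ℂ}
    (h : ketBra v = c • ketBra w) : localState v = c • localState w := by
  rw [localState, h]
  ext j j'
  simp [localState, traceA, Finset.mul_sum]

/-- The action of an operator on the joint system, with possibly different dimensions after it. -/
def applyOp {dA dB dA' dB' : ℕ} (L : Matrix (Fin dA' × Fin dB') (Fin dA × Fin dB) ℂ)
    (v : Ket dA dB) : Ket dA' dB' :=
  WithLp.toLp 2 (L *ᵥ v.ofLp)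

theorem ketBra_applyOp {dA dB dA' dB' : ℕ}
    (L : Matrix (Fin dA' × Fin dB') (Fin dA × Fin dB) ℂ) (v : Ket dA dB) :
    ketBra (applyOp L v) = L * ketBra v * Lᴴ := by
  simp [ketBra, applyOp, Matrix.mul_vecMulVec, Matrix.vecMulVec_mul, Matrix.star_mulVec]

theorem coeffMatrix_applyOp_alice {dA dB d' : ℕ} (K : Matrix (Fin d') (Fin dA) ℂ)
    (v : Ket dA dB) :
    coeffMatrix (applyOp (K ⊗ₖ (1 : Matrix (Fin dB) (Fin dB) ℂ)) v) = coeffMatrix v * Kᵀ := by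
  ext j i
  simp [coeffMatrix, applyOp, Matrix.mulVec, dotProduct, Matrix.mul_apply, Fintype.sum_prod_type,
    Matrix.one_apply, mul_comm]

theorem coeffMatrix_applyOp_bob {dA dB d' : ℕ} (K : Matrix (Fin d') (Fin dB) ℂ)
    (v : Ket dA dB) :
    coeffMatrix (applyOp ((1 : Matrix (Fin dA) (Fin dA) ℂ) ⊗ₖ K) v) = K * coeffMatrix v := by
  ext j i
  simp [coeffMatrix, applyOp, Matrix.mulVec, dotProduct, Matrix.mul_apply, Fintype.sum_prod_type,
    Matrix.one_apply]

open scoped MatrixOrder in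
/-- If positive semidefinite matrices sum to a multiple of a rank-one projection, then each of them
is a multiple of it. -/
theorem eq_smul_ketBra_of_sum_eq {dA dB n : ℕ} {Φ : Ket dA dB} (hΦ : ‖Φ‖ = 1)
    {A : Fin n → Op dA dB} (hA : ∀ k, (A k).PosSemidef) {c : ℂ} (h : ∑ k, A k = c • ketBra Φ)
    (k : Fin n) : A k = ((A k).trace.re : ℂ) • ketBra Φ := by
  set P := ketBra Φ with hP
  have hPh : Pᴴ = P := (ketBra_posSemidef Φ).isHermitian
  have htrP : P.trace = 1 := by rw [trace_ketBra, hΦ]; simp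
  have hdot : star Φ.ofLp ⬝ᵥ Φ.ofLp = 1 := by
    rw [hP, ketBra, Matrix.trace_vecMulVec] at htrP
    rwa [dotProduct_comm]
  have hPP : P * P = P := by
    rw [hP, ketBra, Matrix.vecMulVec_mul_vecMulVec, hdot, one_smul]
  have hQA (l : Fin n) : ((1 - P)ᴴ * A l * (1 - P)).PosSemidef :=
    (hA l).conjTranspose_mul_mul_same _
  have hsum : ∑ l, ((1 - P)ᴴ * A l * (1 - P)).trace = 0 := by
    rw [← Matrix.trace_sum, ← Finset.sum_mul, ← Finset.mul_sum, h]
    simp [Matrix.mul_assoc, mul_sub, hPP]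
  have hzero : (1 - P)ᴴ * A k * (1 - P) = 0 :=
    (hQA k).trace_eq_zero_iff.1
      ((Finset.sum_eq_zero_iff_of_nonneg fun l _ => (hQA l).trace_nonneg).1 hsum k
        (Finset.mem_univ k))
  have hAQ : A k * (1 - P) = 0 := by
    obtain ⟨B, hB⟩ := CStarAlgebra.nonneg_iff_eq_star_mul_self.1 (hA k).nonneg
    rw [hB, Matrix.star_eq_conjTranspose] at hzero ⊢
    have : (B * (1 - P))ᴴ * (B * (1 - P)) = 0 := by
      rw [Matrix.conjTranspose_mul, ← hzero]
      simp only [Matrix.mul_assoc]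
    rw [Matrix.mul_assoc, Matrix.conjTranspose_mul_self_eq_zero.1 this, Matrix.mul_zero]
  have hAP : A k = A k * P := by
    rw [mul_sub, mul_one, sub_eq_zero] at hAQ
    exact hAQ
  have hPA : A k = P * A k := by
    have := congrArg Matrix.conjTranspose hAP
    rwa [Matrix.conjTranspose_mul, hPh, (hA k).isHermitian.eq] at this
  -- `A k = P * A k * P`, and compression by `P` leaves only the expectation value in `Φ`
  have hq : A k = (star Φ.ofLp ⬝ᵥ (A k *ᵥ Φ.ofLp)) • P := by
    conv_lhs => rw [hPA, hAP, hP, ketBra]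
    rw [← Matrix.mul_assoc, Matrix.vecMulVec_mul, Matrix.vecMulVec_mul_vecMulVec,
      ← Matrix.dotProduct_mulVec, hP, ketBra, Matrix.vecMulVec_smul]
  have htr : (A k).trace = star Φ.ofLp ⬝ᵥ (A k *ᵥ Φ.ofLp) := by
    conv_lhs => rw [hq]
    simp [htrP]
  have hre : (((A k).trace.re : ℝ) : ℂ) = (A k).trace :=
    (Complex.eq_re_of_ofReal_le (r := 0) (by simpa using (hA k).trace_nonneg)).symm
  rw [hre, htr]
  exact hq

/-! ### Averages of potentials over the branches of a protocol -/

theorem Protocol.run_posSemidef {N : ℕ} {outA outB : Fin N → ℕ} {dA dB : ℕ}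
    (P : Protocol outA outB dA dB) {ρ : Op dA dB} (hρ : ρ.PosSemidef) (m : Fin N) :
    (P.run ρ m).PosSemidef := by
  induction P with
  | halt m₀ =>
    rw [Protocol.run]
    by_cases h : m = m₀
    · subst h; simpa using hρ
    · rw [Pi.single_eq_of_ne h]; exact Matrix.PosSemidef.zero
  | alice d' K complete next ih =>
    exact Matrix.posSemidef_sum _ fun k _ => ih k (hρ.mul_mul_conjTranspose_same _)
  | bob d' K complete next ih =>
    exact Matrix.posSemidef_sum _ fun k _ => ih k (hρ.mul_mul_conjTranspose_same _)

/-- Functions `f` of positive semidefinite matrices of all sizes that are homogeneous,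
superadditive, and depend only on the nonzero part of the spectrum. -/
structure IsLocalPotential (f : ∀ d : ℕ, Matrix (Fin d) (Fin d) ℂ → ℝ) : Prop where
  smul : ∀ {d : ℕ} {ρ : Matrix (Fin d) (Fin d) ℂ} {c : ℝ}, ρ.PosSemidef → 0 ≤ c →
    f d ((c : ℂ) • ρ) = c * f d ρ
  sum_le : ∀ {d n : ℕ} {ρ : Fin n → Matrix (Fin d) (Fin d) ℂ}, (∀ k, (ρ k).PosSemidef) →
    ∑ k, f d (ρ k) ≤ f d (∑ k, ρ k)
  comm : ∀ {m n : ℕ} (M : Matrix (Fin m) (Fin n) ℂ), f m (M * Mᴴ) = f n (Mᴴ * M)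

theorem isLocalPotential_trace : IsLocalPotential fun _ ρ => ρ.trace.re where
  smul _ _ := by simp
  sum_le _ := by simp [Matrix.trace_sum]
  comm M := by rw [Matrix.trace_mul_comm]

theorem isLocalPotential_neg_trace : IsLocalPotential fun _ ρ => -ρ.trace.re where
  smul _ _ := by simp
  sum_le _ := by simp [Matrix.trace_sum]
  comm M := by rw [Matrix.trace_mul_comm]

theorem isLocalPotential_schattenNorm {α : ℝ} (hα : 0 < α) (hα1 : α ≤ 1) :
    IsLocalPotential fun _ ρ => schattenNorm α ρ where
  smul hρ hc := schattenNorm_smul hρ hc hα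
  sum_le h := sum_schattenNorm_le hα hα1 h
  comm M := by rw [schattenNorm, tracePow_mul_conjTranspose_comm M hα, schattenNorm]

theorem isLocalPotential_neg_schattenNorm {α : ℝ} (hα : 1 ≤ α) :
    IsLocalPotential fun _ ρ => -schattenNorm α ρ where
  smul hρ hc := by rw [schattenNorm_smul hρ hc (by linarith)]; ring
  sum_le h := by
    rw [Finset.sum_neg_distrib]
    exact neg_le_neg (schattenNorm_sum_le hα h)
  comm M := by
    rw [schattenNorm, tracePow_mul_conjTranspose_comm M (by linarith), schattenNorm]

/-- One round of a protocol: `R k m` is the unnormalised state of outcome `m` in the branch `k`,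
`g m` the value of a potential in the final state `Φ m`, and `x k` bounds the average of `g` in the
branch `k`. As `Φ m` is pure, every branch contributes a multiple of it to outcome `m`, so that the
averages of the branches add up to the average over the whole protocol. -/
theorem sum_mul_le_of_branches {N n : ℕ} {outA outB : Fin N → ℕ} {p : Fin N → ℝ}
    {Φ : ∀ m, Ket (outA m) (outB m)} (hΦ : ∀ m, ‖Φ m‖ = 1)
    {R : Fin n → ∀ m, Op (outA m) (outB m)} (hR : ∀ k m, (R k m).PosSemidef)
    (h : ∀ m, ∑ k, R k m = (p m : ℂ) • ketBra (Φ m)) {g : Fin N → ℝ} {x : Fin n → ℝ} {y : ℝ}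
    (ih : ∀ k (q : Fin N → ℝ), (∀ m, R k m = (q m : ℂ) • ketBra (Φ m)) →
      ∑ m, q m * g m ≤ x k) (hx : ∑ k, x k ≤ y) : ∑ m, p m * g m ≤ y := by
  have hp (m : Fin N) : p m = ∑ k, (R k m).trace.re := by
    have := congrArg Matrix.trace (h m)
    rw [Matrix.trace_smul, trace_ketBra, hΦ, Matrix.trace_sum] at this
    simpa using (congrArg Complex.re this).symm
  calc ∑ m, p m * g m = ∑ k, ∑ m, (R k m).trace.re * g m := by
        simp only [hp, Finset.sum_mul]
        exact Finset.sum_comm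
    _ ≤ ∑ k, x k := Finset.sum_le_sum fun k _ =>
        ih k _ fun m => eq_smul_ketBra_of_sum_eq (hΦ m) (fun k => hR k m) (h m) k
    _ ≤ y := hx

namespace IsLocalPotential

variable {f : ∀ d : ℕ, Matrix (Fin d) (Fin d) ℂ → ℝ}

/-- A measurement by the first party splits `ρ_B`. -/
theorem sum_alice_le (hf : IsLocalPotential f) {dA dB n : ℕ} {d' : Fin n → ℕ}
    (K : ∀ k, Matrix (Fin (d' k)) (Fin dA) ℂ) (hK : ∑ k, (K k)ᴴ * K k = 1) (v : Ket dA dB) :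
    ∑ k, f dB (localState (applyOp (K k ⊗ₖ (1 : Matrix (Fin dB) (Fin dB) ℂ)) v)) ≤
      f dB (localState v) := by
  refine (hf.sum_le fun k => localState_posSemidef _).trans_eq (congrArg _ ?_)
  have hK' : ∑ k, (K k)ᵀ * ((K k)ᵀ)ᴴ = 1 := by
    have := congrArg Matrix.transpose hK
    simpa [Matrix.transpose_sum, Matrix.conjTranspose, Matrix.transpose_map] using this
  simp only [localState_eq, coeffMatrix_applyOp_alice, Matrix.conjTranspose_mul]
  calc ∑ k, coeffMatrix v * (K k)ᵀ * (((K k)ᵀ)ᴴ * (coeffMatrix v)ᴴ)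
      = coeffMatrix v * (∑ k, (K k)ᵀ * ((K k)ᵀ)ᴴ) * (coeffMatrix v)ᴴ := by
        simp only [Matrix.mul_sum, Matrix.sum_mul, Matrix.mul_assoc]
    _ = _ := by rw [hK', Matrix.mul_one]

/-- A measurement by the second party splits `Rᴴ R`, which has the same nonzero spectrum as
`ρ_B = R Rᴴ`. -/
theorem sum_bob_le (hf : IsLocalPotential f) {dA dB n : ℕ} {d' : Fin n → ℕ}
    (K : ∀ k, Matrix (Fin (d' k)) (Fin dB) ℂ) (hK : ∑ k, (K k)ᴴ * K k = 1) (v : Ket dA dB) :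
    ∑ k, f (d' k) (localState (applyOp ((1 : Matrix (Fin dA) (Fin dA) ℂ) ⊗ₖ K k) v)) ≤
      f dB (localState v) := by
  simp only [localState_eq, coeffMatrix_applyOp_bob, hf.comm]
  refine (hf.sum_le fun k => Matrix.posSemidef_conjTranspose_mul_self _).trans_eq
    (congrArg _ ?_)
  simp only [Matrix.conjTranspose_mul]
  calc ∑ k, (coeffMatrix v)ᴴ * (K k)ᴴ * (K k * coeffMatrix v)
      = (coeffMatrix v)ᴴ * (∑ k, (K k)ᴴ * K k) * coeffMatrix v := by
        simp only [Matrix.mul_sum, Matrix.sum_mul, Matrix.mul_assoc]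
    _ = _ := by rw [hK, Matrix.mul_one]

/-- Potentials do not increase on average under a protocol that ends in pure states. The initial
ket `v` need not be normalised, which lets the induction pass to the branches. -/
theorem average_le (hf : IsLocalPotential f) {dA dB N : ℕ} {outA outB : Fin N → ℕ}
    (P : Protocol outA outB dA dB) {Φ : ∀ m, Ket (outA m) (outB m)} (hΦ : ∀ m, ‖Φ m‖ = 1)
    (v : Ket dA dB) (p : Fin N → ℝ)
    (h : ∀ m, P.run (ketBra v) m = (p m : ℂ) • ketBra (Φ m)) :
    ∑ m, p m * f _ (localState (Φ m)) ≤ f _ (localState v) := by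
  induction P generalizing p with
  | halt m₀ =>
    have hp (m : Fin N) : p m = (Protocol.run (.halt m₀) (ketBra v) m).trace.re := by
      rw [h, Matrix.trace_smul, trace_ketBra, hΦ]; simp
    rw [Finset.sum_eq_single m₀]
    · have h0 := h m₀
      rw [Protocol.run, Pi.single_eq_same] at h0
      have hp0 : 0 ≤ p m₀ := by
        rw [hp, Protocol.run, Pi.single_eq_same, trace_ketBra, Complex.ofReal_re]; positivity
      rw [localState_eq_smul h0, hf.smul (localState_posSemidef _) hp0]
    · intro m _ hm
      rw [hp, Protocol.run, Pi.single_eq_of_ne hm]; simp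
    · simp
  | alice d' K complete next ih =>
    refine sum_mul_le_of_branches hΦ (fun k m => (next k).run_posSemidef ?_ m) h (fun k q hq => ?_)
      (hf.sum_alice_le K complete v)
    · exact (ketBra_posSemidef v).mul_mul_conjTranspose_same _
    · exact ih k _ q (by simpa only [ketBra_applyOp] using hq)
  | bob d' K complete next ih =>
    refine sum_mul_le_of_branches hΦ (fun k m => (next k).run_posSemidef ?_ m) h (fun k q hq => ?_)
      (hf.sum_bob_le K complete v)
    · exact (ketBra_posSemidef v).mul_mul_conjTranspose_same _
    · exact ih k _ q (by simpa only [ketBra_applyOp] using hq)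

end IsLocalPotential

/-! ### The generalised entanglement entropy -/

theorem tracePow_localState_pos {dA dB : ℕ} {Ψ : Ket dA dB} (hΨ : ‖Ψ‖ = 1) (α : ℝ) :
    0 < tracePow α (localState Ψ) :=
  tracePow_pos (localState_posSemidef Ψ) (by rw [trace_localState, hΨ]; simp) α

theorem schattenNorm_localState_pos {dA dB : ℕ} {Ψ : Ket dA dB} (hΨ : ‖Ψ‖ = 1) (α : ℝ) :
    0 < schattenNorm α (localState Ψ) :=
  Real.rpow_pos_of_pos (tracePow_localState_pos hΨ α) _

theorem isSeparable_iff_rank_le_one {dA dB : ℕ} (Ψ : Ket dA dB) :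
    IsSeparable Ψ ↔ (coeffMatrix Ψ).rank ≤ 1 := by
  constructor
  · rintro ⟨φ, χ, h⟩
    have : coeffMatrix Ψ = Matrix.vecMulVec χ.ofLp φ.ofLp := by
      ext j i
      rw [Matrix.vecMulVec_apply, mul_comm]
      exact h i j
    rw [this]
    exact Matrix.rank_vecMulVec_le _ _
  · intro h
    obtain ⟨χ, hχ⟩ := finrank_le_one_iff.1 h
    choose c hc using hχ
    -- the `i`-th column of `coeffMatrix Ψ` is a multiple of `χ`
    let col (i : Fin dA) : LinearMap.range (coeffMatrix Ψ).mulVecLin :=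
      ⟨(coeffMatrix Ψ).mulVecLin (Pi.single i 1), LinearMap.mem_range_self _ _⟩
    refine ⟨WithLp.toLp 2 fun i => c (col i), WithLp.toLp 2 χ.1, fun i j => ?_⟩
    have : c (col i) * χ.1 j = (coeffMatrix Ψ *ᵥ Pi.single i 1) j :=
      congrFun (congrArg Subtype.val (hc (col i))) j
    rw [Matrix.mulVec_single_one] at this
    exact this.symm

/-- As the eigenvalues of `ρ_B` sum to one and `x ^ α` differs from `x` strictly inside `(0, 1)`, on
the same side everywhere, `Tr[ρ_B^α] = 1` forces the eigenvalues into `{0, 1}`, so `ρ_B` has rank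
one. -/
theorem tracePow_localState_eq_one_iff {dA dB : ℕ} {Ψ : Ket dA dB} (hΨ : ‖Ψ‖ = 1) {α : ℝ}
    (hα : 0 < α) (hα1 : α ≠ 1) : tracePow α (localState Ψ) = 1 ↔ IsSeparable Ψ := by
  have hρ := localState_posSemidef Ψ
  have hsum : ∑ i, hρ.isHermitian.eigenvalues i = 1 := by
    rw [sum_eigenvalues_eq, trace_localState, hΨ]; simp
  rw [tracePow_eq_sum hρ.isHermitian, sum_rpow_eq_one_iff hρ.eigenvalues_nonneg hsum hα hα1,
    forall_zero_or_one_iff_card_le_one hsum, ← hρ.isHermitian.rank_eq_card_non_zero_eigs,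
    isSeparable_iff_rank_le_one, localState_eq, Matrix.rank_self_mul_conjTranspose]

theorem REE_eq_zero_iff {dA dB : ℕ} {Ψ : Ket dA dB} (hΨ : ‖Ψ‖ = 1) {α : ℝ}
    (hα : 0 < α) (hα1 : α ≠ 1) : REE α Ψ = 0 ↔ IsSeparable Ψ := by
  rw [← tracePow_localState_eq_one_iff hΨ hα hα1, REE, renyiEntropy, mul_eq_zero,
    or_iff_right (one_div_ne_zero (sub_ne_zero.2 hα1.symm))]
  refine ⟨Real.eq_one_of_pos_of_log_eq_zero (tracePow_localState_pos hΨ α), fun h => ?_⟩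
  rw [h, Real.log_one]

theorem GEE_eq_zero_iff {dA dB : ℕ} {Ψ : Ket dA dB} (hΨ : ‖Ψ‖ = 1) {α : ℝ}
    (hα : 0 < α) (hα1 : α ≠ 1) (s : ℝ) : GEE α s Ψ = 0 ↔ IsSeparable Ψ := by
  rw [← REE_eq_zero_iff hΨ hα hα1, GEE]
  split_ifs with hs
  · rfl
  · have h : s * (1 - α) ≠ 0 := mul_ne_zero hs (sub_ne_zero.2 hα1.symm)
    rw [mul_eq_zero, or_iff_right (one_div_ne_zero h), sub_eq_zero, Real.exp_eq_one_iff,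
      mul_eq_zero, or_iff_right h]

theorem exp_mul_REE {dA dB : ℕ} {Ψ : Ket dA dB} (hΨ : ‖Ψ‖ = 1) {α : ℝ} (hα1 : α ≠ 1) (s : ℝ) :
    Real.exp (s * (1 - α) * REE α Ψ) = tracePow α (localState Ψ) ^ s := by
  have h : 1 - α ≠ 0 := sub_ne_zero.2 hα1.symm
  rw [Real.rpow_def_of_pos (tracePow_localState_pos hΨ α), REE, renyiEntropy]
  congr 1
  field_simp

/-- The generalised entanglement entropy is a deformed logarithm of the Schatten (quasi-)norm of
the local state. -/
theorem GEE_eq_deformedLog {dA dB : ℕ} {Ψ : Ket dA dB} (hΨ : ‖Ψ‖ = 1) {α : ℝ}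
    (hα : 0 < α) (hα1 : α ≠ 1) (s : ℝ) :
    GEE α s Ψ = α / (1 - α) * deformedLog (α * s) (schattenNorm α (localState Ψ)) := by
  have ht := tracePow_localState_pos hΨ α
  have h : 1 - α ≠ 0 := sub_ne_zero.2 hα1.symm
  rw [GEE, deformedLog, schattenNorm]
  by_cases hs : s = 0
  · rw [if_pos hs, if_pos (by rw [hs, mul_zero]), REE, renyiEntropy, Real.log_rpow ht]
    field_simp
  · rw [if_neg hs, if_neg (mul_ne_zero hα.ne' hs), exp_mul_REE hΨ hα1, ← Real.rpow_mul ht.le,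
      ← mul_assoc, one_div_mul_cancel hα.ne', one_mul]
    field_simp

/-- Away from `s = 0` the generalised entropy is a difference quotient at `0` of
`s ↦ exp (s (1 - α) E_α) / (1 - α)`. -/
theorem tendsto_GEE {dA dB : ℕ} (Ψ : Ket dA dB) {α : ℝ} (hα1 : α ≠ 1) :
    Tendsto (fun s : ℝ => GEE α s Ψ) (𝓝[≠] 0) (𝓝 (REE α Ψ)) := by
  have h : 1 - α ≠ 0 := sub_ne_zero.2 hα1.symm
  have hd : HasDerivAt (fun s : ℝ => 1 / (1 - α) * Real.exp (s * ((1 - α) * REE α Ψ)))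
      (REE α Ψ) 0 := by
    refine ((((hasDerivAt_id' (0 : ℝ)).mul_const ((1 - α) * REE α Ψ)).exp).const_mul
      (1 / (1 - α))).congr_deriv ?_
    rw [zero_mul, Real.exp_zero]
    field_simp
  refine (hasDerivAt_iff_tendsto_slope.1 hd).congr' ?_
  filter_upwards [self_mem_nhdsWithin] with s hs
  have hs0 : s ≠ 0 := hs
  rw [slope_def_field, GEE, if_neg hs0, zero_mul, Real.exp_zero, mul_assoc s]
  field_simp
  ring

theorem GEE_one {dA dB : ℕ} {Ψ : Ket dA dB} (hΨ : ‖Ψ‖ = 1) {α : ℝ} (hα1 : α ≠ 1) :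
    GEE α 1 Ψ = tsallisEntropy α (localState Ψ) := by
  rw [GEE, if_neg one_ne_zero, exp_mul_REE hΨ hα1, Real.rpow_one, one_mul, tsallisEntropy]

/-! ### SLOCC monotonicity -/

theorem SLOCCTransforms.sum_mul_le {f : ∀ d : ℕ, Matrix (Fin d) (Fin d) ℂ → ℝ}
    (hf : IsLocalPotential f) {dA dB N : ℕ} {outA outB : Fin N → ℕ} {Ψ : Ket dA dB}
    {p : Fin N → ℝ} {Φ : ∀ m, Ket (outA m) (outB m)} (h : SLOCCTransforms Ψ p Φ) :
    ∑ m, p m * f _ (localState (Φ m)) ≤ f _ (localState Ψ) := by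
  obtain ⟨-, hΦ, P, hP⟩ := h
  exact hf.average_le P hΦ Ψ p hP

theorem SLOCCTransforms.prob_nonneg {dA dB N : ℕ} {outA outB : Fin N → ℕ} {Ψ : Ket dA dB}
    {p : Fin N → ℝ} {Φ : ∀ m, Ket (outA m) (outB m)} (h : SLOCCTransforms Ψ p Φ) (m : Fin N) :
    0 ≤ p m := by
  obtain ⟨-, hΦ, P, hP⟩ := h
  have := (P.run_posSemidef (ketBra_posSemidef Ψ) m).trace_nonneg
  rw [hP, Matrix.trace_smul, trace_ketBra, hΦ] at this
  simpa using this

/-- The trace and its negative are both potentials, so probability is conserved. -/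
theorem SLOCCTransforms.sum_prob {dA dB N : ℕ} {outA outB : Fin N → ℕ} {Ψ : Ket dA dB}
    {p : Fin N → ℝ} {Φ : ∀ m, Ket (outA m) (outB m)} (h : SLOCCTransforms Ψ p Φ) :
    ∑ m, p m = 1 := by
  have h1 := h.sum_mul_le isLocalPotential_trace
  have h2 := h.sum_mul_le isLocalPotential_neg_trace
  simp only [trace_localState, h.1, h.2.1, Complex.ofReal_re, one_pow, mul_one, mul_neg,
    Finset.sum_neg_distrib, neg_le_neg_iff] at h1 h2
  exact le_antisymm h1 h2

theorem sum_GEE_sub_nonpos {α s : ℝ} (h : (α, s) ∈ Ω) {dA dB N : ℕ} {outA outB : Fin N → ℕ}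
    {Ψ : Ket dA dB} {p : Fin N → ℝ} {Φ : ∀ m, Ket (outA m) (outB m)}
    (hT : SLOCCTransforms Ψ p Φ) : ∑ m, p m * (GEE α s (Φ m) - GEE α s Ψ) ≤ 0 := by
  have hΨ := hT.1
  have hΦ := hT.2.1
  have hE (hα : 0 < α) (hα1 : α ≠ 1) : ∑ m, p m * (GEE α s (Φ m) - GEE α s Ψ) =
      α / (1 - α) * ∑ m, p m * (deformedLog (α * s) (schattenNorm α (localState (Φ m))) -
        deformedLog (α * s) (schattenNorm α (localState Ψ))) := by
    rw [Finset.mul_sum]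
    refine Finset.sum_congr rfl fun m _ => ?_
    rw [GEE_eq_deformedLog hΨ hα hα1, GEE_eq_deformedLog (hΦ m) hα hα1]
    ring
  -- on both parts of `Ω` the exponent `α * s` lies on the side of `1` that fits the sign of `1 - α`
  rcases h with ⟨hα, hα1, hs⟩ | ⟨hα1, hs⟩
  · dsimp only at hα hα1 hs
    rw [hE hα hα1.ne]
    refine mul_nonpos_of_nonneg_of_nonpos (div_nonneg hα.le (by linarith)) ?_
    refine sum_deformedLog_sub_nonpos hT.prob_nonneg hT.sum_prob
      (fun m => schattenNorm_localState_pos (hΦ m) α) (schattenNorm_localState_pos hΨ α) ?_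
      (hT.sum_mul_le (isLocalPotential_schattenNorm hα hα1.le))
    rwa [le_div_iff₀ hα, mul_comm] at hs
  · dsimp only at hα1 hs
    have hα : 0 < α := by linarith
    rw [hE hα hα1.ne']
    refine mul_nonpos_of_nonpos_of_nonneg
      (div_nonpos_of_nonneg_of_nonpos hα.le (by linarith)) ?_
    refine sum_deformedLog_sub_nonneg hT.prob_nonneg hT.sum_prob
      (fun m => schattenNorm_localState_pos (hΦ m) α) (schattenNorm_localState_pos hΨ α) ?_ ?_
    · rwa [div_le_iff₀ hα, mul_comm] at hs
    · have := hT.sum_mul_le (isLocalPotential_neg_schattenNorm hα1.le)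
      simpa only [mul_neg, Finset.sum_neg_distrib, neg_le_neg_iff] using this

end Entanglement

theorem proposition1 :
    (∀ α s : ℝ, (α, s) ∈ Entanglement.Ω →
      Entanglement.IsEntanglementMonotone (fun Ψ => Entanglement.GEE α s Ψ)) ∧
    (∀ α : ℝ, 0 < α → α ≠ 1 → ∀ (dA dB : ℕ) (Ψ : Entanglement.Ket dA dB), ‖Ψ‖ = 1 →
      Tendsto (fun s : ℝ => Entanglement.GEE α s Ψ) (𝓝[≠] 0) (𝓝 (Entanglement.REE α Ψ)) ∧
      Entanglement.GEE α 1 Ψ =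
        Entanglement.tsallisEntropy α (Entanglement.localState Ψ)) := by
  refine ⟨fun α s h => ⟨fun Ψ hΨ => ?_, fun Ψ p Φ hT => Entanglement.sum_GEE_sub_nonpos h hT⟩,
    fun α _ hα1 dA dB Ψ hΨ => ⟨Entanglement.tendsto_GEE Ψ hα1, Entanglement.GEE_one hΨ hα1⟩⟩
  rcases h with ⟨hα, hα1, -⟩ | ⟨hα1, -⟩
  · exact Entanglement.GEE_eq_zero_iff hΨ hα hα1.ne s
  · exact Entanglement.GEE_eq_zero_iff hΨ (zero_lt_one.trans hα1) hα1.ne' s
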